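/- A group $G$ is a *Powers group* if $G \neq \{1\}$ and if, for every finite subset $F \subset G \smallsetminus \{1\}$ and every integer $N \ge 1$, there exist a partition $G = X \sqcup Y$ and elements $\gamma_1, \dots, \gamma_N \in G$ such that $fX \cap X = \emptyset$ for all $f \in F$ and $\gamma_i Y \cap \gamma_j Y = \emptyset$ for all $i \neq j$ in $\{1, \dots, N\}$. A group is a *strongly Powers group* if each of its subnormal subgroups $N \neq \{1\}$ is a Powers group; here a subgroup $N$ of $G$ is *subnormal* if there is a finite chain $N = N_0 \le N_1 \le \cdots \le N_m = G$ of subgroups with $N_{j-1}$ normal in $N_j$ for $j = 1, \dots, m$. Let $A, B, C$ be groups, let $\iota_A : C \to A$ and $\iota_B : C \to B$ be injective homomorphisms, and let $$\Gamma = A *_C B = \langle A, B \mid \iota_A(c) = \iota_B(c) \ \ \forall c \in C \rangle$$ be the corresponding amalgam; identify $C$ with a subgroup of $A$ and of $B$. Define subgroups $C_0 \supset C_1 \supset \cdots$ of $C$ by $C_0 = C$ and $$C_k = \Big( \bigcap_{a \in A} a^{-1} C_{k-1} a \Big) \cap \Big( \bigcap_{b \in B} b^{-1} C_{k-1} b \Big)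 \qquad (k \ge 1).$$ **Proposition 1.3.** Assume that $\Gamma$ is countable, that $[A : C] \ge 3$ and $[B : C] \ge 2$ (the indices may be infinite), and that $C_k = \{1\}$ for some $k \ge 0$. Then $\Gamma$ is a strongly Powers group. -/

import Mathlib

open scoped Pointwise

universe u v

section PowersGroups

/-- A Powers group: a group not reduced to one element such that, for every finite subset `F` of
`Γ \ {1}` and every integer `N ≥ 1`, there are a partition `Γ = C ⊔ D` and elements
`γ₁, …, γ_N` of `Γ` with `f C ∩ C = ∅` for all `f ∈ F` and `γⱼ D ∩ γₖ D = ∅` for all `j ≠ k`.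
Here `g • S` is the left translate `{g * s | s ∈ S}`. -/
def IsPowersGroup (Γ : Type*) [Group Γ] : Prop :=
  Nontrivial Γ ∧
    ∀ F : Finset Γ, (1 : Γ) ∉ F → ∀ N : ℕ, 1 ≤ N →
      ∃ C D : Set Γ, C ∪ D = Set.univ ∧ C ∩ D = ∅ ∧
        ∃ γ : Fin N → Γ,
          (∀ f ∈ F, (f • C) ∩ C = ∅) ∧
          (∀ j k : Fin N, j ≠ k → (γ j • D) ∩ (γ k • D) = ∅)

/-- A strongly Powers group: every subnormal subgroup `N ≠ {1}` is a Powers group. -/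
def IsStronglyPowersGroup (Γ : Type*) [Group Γ] : Prop :=
  ∀ N : Subgroup Γ, N.IsSubnormal → N ≠ ⊥ → IsPowersGroup N

end PowersGroups

section Amalgams

/-- The two-element family of types consisting of `A` (at `false`) and `B` (at `true`). -/
def AmalgamFactor (A B : Type u) : Bool → Type u
  | false => A
  | true => B

instance AmalgamFactor.instGroup (A B : Type u) [hA : Group A] [hB : Group B] :
    ∀ i : Bool, Group (AmalgamFactor A B i)
  | false => hA
  | true => hB

/-- The two given homomorphisms `C → A` and `C → B` as one family. -/
def amalgamMap {A B : Type u} {C : Type v} [Group A] [Group B] [Group C]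
    (ιA : C →* A) (ιB : C →* B) : ∀ i : Bool, C →* AmalgamFactor A B i
  | false => ιA
  | true => ιB

/-- The group `A *_C B = ⟨A, B | ιA c = ιB c for all c ∈ C⟩`, that is, the pushout of
`A ← C → B` in the category of groups. -/
abbrev Amalgam {A B : Type u} {C : Type v} [Group A] [Group B] [Group C]
    (ιA : C →* A) (ιB : C →* B) : Type (max u v) :=
  Monoid.PushoutI (amalgamMap ιA ιB)

/-- For `ι : C →* A` (the identification of `C` with a subgroup of `A`) and a subgroup `S` of `C`,
this is the intersection over all `a ∈ A` of the conjugates `a⁻¹ S a`, as a subgroup of `C`;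
it lies in `S`, as one sees with `a = 1`. -/
def interConjugates {A : Type u} {C : Type v} [Group A] [Group C] (ι : C →* A)
    (S : Subgroup C) : Subgroup C :=
  (⨅ a : A, (S.map ι).map (MulAut.conj a⁻¹).toMonoidHom).comap ι

/-- The sequence `C₀ = C` and `Cₖ = (⋂_{a ∈ A} a⁻¹ Cₖ₋₁ a) ∩ (⋂_{b ∈ B} b⁻¹ Cₖ₋₁ b)` for `k ≥ 1`,
as subgroups of `C`. -/
def amalgamCore {A B : Type u} {C : Type v} [Group A] [Group B] [Group C]
    (ιA : C →* A) (ιB : C →* B) : ℕ → Subgroup C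
  | 0 => ⊤
  | k + 1 => interConjugates ιA (amalgamCore ιA ιB k) ⊓ interConjugates ιB (amalgamCore ιA ιB k)

end Amalgams

namespace BassSerre

open Monoid

variable {Γ : Type*} [Group Γ]

/-! The group acts on its Bass–Serre tree, whose edges are the cosets `g C`. A half-tree is coded as
a translate `h • P` of `P = baseHalf G C`, so the geometry becomes a matter of first and last
letters of reduced words. Triviality of some `C_k` says that some ball has trivial pointwise
stabilizer. An element moving no half-tree inside `P` off itself fixes every edge of `P`; as `P`
contains arbitrarily large balls, it is `1` (`eq_one`). Hence every half-tree contains one that a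
given `f ≠ 1` moves off itself, and shrinking successively handles a finite set `F`. A nontrivial
subnormal subgroup moves any half-tree into any other (`exists_smul_subset_smul_of_isSubnormal`). It
therefore carries the complement of `h • P` into each of `N` pairwise disjoint half-trees
(`exists_pairwise_disjoint`), and the trace of `h • P` on the subgroup gives the partition. -/

/-- `IsReduced G C i j g` says that `g` is the product of a nonempty alternating word whose letters
lie in `G false ∖ C` and `G true ∖ C`, with first letter in `G i` and last letter in `G j`. -/
inductive IsReduced (G : Bool → Subgroup Γ) (C : Subgroup Γ) : Bool → Bool → Γ → Prop
  | single {i : Bool} {x : Γ} : x ∈ G i → x ∉ C → IsReduced G C i i x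
  | append {i j l : Bool} {g h : Γ} :
      IsReduced G C i j g → IsReduced G C (!j) l h → IsReduced G C i l (g * h)

/-- `Γ` is the amalgam of its subgroups `G false` and `G true` over `C`. -/
structure IsAmalgam (G : Bool → Subgroup Γ) (C : Subgroup Γ) : Prop where
  le : ∀ i, C ≤ G i
  sup_eq_top : G false ⊔ G true = ⊤
  notMem : ∀ {i j g}, IsReduced G C i j g → g ∉ C

/-- The half-tree at the base edge on the side of the vertex stabilized by `G true`, as a subset
of `Γ`: the elements of `C` and those with a reduced word beginning in `G true`. -/
def baseHalf (G : Bool → Subgroup Γ) (C : Subgroup Γ) : Set Γ :=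
  {g | g ∈ C ∨ ∃ j, IsReduced G C true j g}

/-! ### Reduced words and translates of the base half-tree -/

section Words

variable {G : Bool → Subgroup Γ} {C : Subgroup Γ}

theorem IsReduced.inv {i j : Bool} {g : Γ} (hg : IsReduced G C i j g) :
    IsReduced G C j i g⁻¹ := by
  induction hg with
  | single hx hC => exact .single (inv_mem hx) (by simpa using hC)
  | @append i j l g h _ _ ihg ihh =>
    rw [mul_inv_rev]
    exact .append ihh (by simpa using ihg)

theorem IsReduced.last {i j : Bool} {g : Γ} (hg : IsReduced G C i j g) :
    (i = j ∧ g ∈ G j ∧ g ∉ C) ∨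
      ∃ w x, IsReduced G C i (!j) w ∧ x ∈ G j ∧ x ∉ C ∧ g = w * x := by
  induction hg with
  | single hx hC => exact .inl ⟨rfl, hx, hC⟩
  | @append i j l g h hg hh ihg ihh =>
    right
    rcases ihh with ⟨rfl, h1, h2⟩ | ⟨w, x, hw, hx, hC, rfl⟩
    · exact ⟨g, h, by simpa using hg, h1, h2, rfl⟩
    · exact ⟨g * w, x, .append hg hw, hx, hC, by group⟩

theorem IsReduced.head {i j : Bool} {g : Γ} (hg : IsReduced G C i j g) :
    (i = j ∧ g ∈ G i ∧ g ∉ C) ∨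
      ∃ x w, x ∈ G i ∧ x ∉ C ∧ IsReduced G C (!i) j w ∧ g = x * w := by
  rcases hg.inv.last with ⟨rfl, h1, h2⟩ | ⟨w, x, hw, hx, hC, h⟩
  · exact .inl ⟨rfl, by simpa using h1, by simpa using h2⟩
  · exact .inr ⟨x⁻¹, w⁻¹, inv_mem hx, by simpa using hC, hw.inv, by
      rw [← mul_inv_rev, ← h, inv_inv]⟩

namespace IsAmalgam

variable (H : IsAmalgam G C)

include H

theorem isReduced_mul_base {i j : Bool} {g c : Γ} (hg : IsReduced G C i j g) (hc : c ∈ C) :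
    IsReduced G C i j (g * c) := by
  have key : ∀ x ∈ G j, x ∉ C → IsReduced G C j j (x * c) := fun x hx hC =>
    .single (mul_mem hx (H.le j hc)) (by rwa [Subgroup.mul_mem_cancel_right _ hc])
  rcases hg.last with ⟨rfl, h1, h2⟩ | ⟨w, x, hw, hx, hC, rfl⟩
  · exact key g h1 h2
  · rw [mul_assoc]
    exact .append hw (by simpa using key x hx hC)

theorem isReduced_base_mul {i j : Bool} {g c : Γ} (hg : IsReduced G C i j g) (hc : c ∈ C) :
    IsReduced G C i j (c * g) := by
  simpa using (H.isReduced_mul_base hg.inv (inv_mem hc)).inv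

theorem mem_or_isReduced_mul {i j k : Bool} {g x : Γ} (hg : IsReduced G C i j g)
    (hx : x ∈ G k) : x * g ∈ C ∨ ∃ i j, IsReduced G C i j (x * g) := by
  by_cases hxC : x ∈ C
  · exact .inr ⟨i, j, H.isReduced_base_mul hg hxC⟩
  by_cases hik : i = k
  · subst hik
    rcases hg.head with ⟨rfl, h1, h2⟩ | ⟨y, w, hy, hC, hw, rfl⟩
    · by_cases h : x * g ∈ C
      · exact .inl h
      · exact .inr ⟨i, i, .single (mul_mem hx h1) h⟩
    · rw [← mul_assoc]
      by_cases h : x * y ∈ C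
      · exact .inr ⟨_, _, H.isReduced_base_mul hw h⟩
      · exact .inr ⟨_, _, .append (.single (mul_mem hx hy) h) hw⟩
  · have : i = !k := by cases i <;> cases k <;> simp_all
    subst this
    exact .inr ⟨_, _, .append (.single hx hxC) hg⟩

theorem mem_or_isReduced (g : Γ) : g ∈ C ∨ ∃ i j, IsReduced G C i j g := by
  have hg : g ∈ G false ⊔ G true := H.sup_eq_top ▸ Subgroup.mem_top g
  rw [Subgroup.sup_eq_closure] at hg
  have step : ∀ x ∈ (G false : Set Γ) ∪ G true, ∀ y,
      (y ∈ C ∨ ∃ i j, IsReduced G C i j y) → x * y ∈ C ∨ ∃ i j, IsReduced G C i j (x * y) := by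
    intro x hx y hy
    obtain ⟨k, hk⟩ : ∃ k, x ∈ G k := by
      rcases hx with hx | hx
      exacts [⟨_, hx⟩, ⟨_, hx⟩]
    rcases hy with hy | ⟨i, j, hy⟩
    · by_cases hx : x ∈ C
      · exact .inl (mul_mem hx hy)
      · exact .inr ⟨k, k, H.isReduced_mul_base (.single hk hx) hy⟩
    · exact H.mem_or_isReduced_mul hy hk
  induction hg using Subgroup.closure_induction_left with
  | one => exact .inl (one_mem C)
  | mul_left x hx y _ ih => exact step x hx y ih
  | inv_mul_cancel x hx y _ ih =>
    refine step x⁻¹ ?_ y ih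
    simpa using hx

/-- With different first letters, `g⁻¹ * g = 1` would be a reduced word lying in `C`. -/
theorem fst_unique {i i' j j' : Bool} {g : Γ} (h : IsReduced G C i j g)
    (h' : IsReduced G C i' j' g) : i = i' := by
  by_contra hne
  obtain rfl : i' = !i := by cases i <;> cases i' <;> simp_all
  exact H.notMem (.append h.inv h') (by simp [one_mem])

theorem notMem_baseHalf_iff {g : Γ} :
    g ∉ baseHalf G C ↔ ∃ j, IsReduced G C false j g := by
  constructor
  · intro hg
    rcases H.mem_or_isReduced g with h | ⟨i, j, h⟩
    · exact absurd (.inl h) hg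
    · cases i
      · exact ⟨j, h⟩
      · exact absurd (.inr ⟨j, h⟩) hg
  · rintro ⟨j, h⟩ (h' | ⟨j', h'⟩)
    · exact H.notMem h h'
    · exact absurd (H.fst_unique h h') (by simp)

theorem smul_baseHalf_of_mem {c : Γ} (hc : c ∈ C) : c • baseHalf G C = baseHalf G C := by
  have : ∀ c ∈ C, ∀ x ∈ baseHalf G C, c * x ∈ baseHalf G C := by
    rintro c hc x (hx | ⟨j, hx⟩)
    · exact .inl (mul_mem hc hx)
    · exact .inr ⟨j, H.isReduced_base_mul hx hc⟩
  ext x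
  rw [Set.mem_smul_set_iff_inv_smul_mem, smul_eq_mul]
  exact ⟨fun h => by simpa using this c hc _ h, this _ (inv_mem hc) x⟩

/-- A reduced word ending in `G false` moves the base half-tree into a set of reduced words with the
same first letter. -/
theorem isReduced_of_mem_smul {i : Bool} {g x : Γ} (hg : IsReduced G C i false g)
    (hx : x ∈ g • baseHalf G C) : ∃ j, IsReduced G C i j x := by
  obtain ⟨y, hy | ⟨j, hy⟩, rfl⟩ := hx
  · exact ⟨false, H.isReduced_mul_base hg hy⟩
  · exact ⟨j, .append hg hy⟩

theorem smul_subset_baseHalf {g : Γ} (hg : IsReduced G C true false g) :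
    g • baseHalf G C ⊆ baseHalf G C := fun _ hx => .inr (H.isReduced_of_mem_smul hg hx)

theorem smul_subset_compl_baseHalf {g : Γ} (hg : IsReduced G C false false g) :
    g • baseHalf G C ⊆ (baseHalf G C)ᶜ := fun _ hx =>
  H.notMem_baseHalf_iff.2 (H.isReduced_of_mem_smul hg hx)

/-- A reduced word ending in `G true` moves the complement of the base half-tree into a set of
reduced words with the same first letter. -/
theorem isReduced_of_mem_smul_compl {i : Bool} {g x : Γ} (hg : IsReduced G C i true g)
    (hx : x ∈ g • (baseHalf G C)ᶜ) : ∃ j, IsReduced G C i j x := by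
  obtain ⟨y, hy, rfl⟩ := hx
  obtain ⟨j, hy⟩ := H.notMem_baseHalf_iff.1 hy
  exact ⟨j, .append hg hy⟩

theorem smul_compl_subset_baseHalf {b : Γ} (hb : IsReduced G C true true b) :
    b • (baseHalf G C)ᶜ ⊆ baseHalf G C := fun _ hx =>
  .inr (H.isReduced_of_mem_smul_compl hb hx)

end IsAmalgam

end Words

/-! ### Relative position of half-trees and fixed edges -/

/-- The amalgams with `[G false : C] ≥ 3` and `[G true : C] ≥ 2`. -/
structure IsNondegenerate (G : Bool → Subgroup Γ) (C : Subgroup Γ) : Prop extends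
    IsAmalgam G C where
  exists_false : ∀ x ∈ G false, ∃ a ∈ G false, a ∉ C ∧ x * a ∉ C
  exists_true : ∃ b ∈ G true, b ∉ C

namespace IsNondegenerate

variable {G : Bool → Subgroup Γ} {C : Subgroup Γ} (H : IsNondegenerate G C)

include H

local notation "P" => baseHalf G C

/-- This is where index at least 3 enters: a letter can be chosen outside `C` that also avoids being
absorbed into `C` by the last letter of `w`. -/
theorem exists_isReduced_mul {i j : Bool} {w : Γ} (hw : IsReduced G C i j w) :
    ∃ a, IsReduced G C false false a ∧ IsReduced G C i false (w * a) := by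
  cases j
  · rcases hw.last with ⟨rfl, h1, _⟩ | ⟨w, x, hw', hx, -, rfl⟩
    · obtain ⟨a, ha, haC, hxa⟩ := H.exists_false w h1
      exact ⟨a, .single ha haC, .single (mul_mem h1 ha) hxa⟩
    · obtain ⟨a, ha, haC, hxa⟩ := H.exists_false x hx
      refine ⟨a, .single ha haC, ?_⟩
      rw [mul_assoc]
      exact .append hw' (.single (mul_mem hx ha) hxa)
  · obtain ⟨a, ha, haC, -⟩ := H.exists_false 1 (one_mem _)
    exact ⟨a, .single ha haC, .append hw (.single ha haC)⟩

theorem exists_isReduced_false : ∃ a, IsReduced G C false false a := by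
  obtain ⟨a, ha, haC, -⟩ := H.exists_false 1 (one_mem _)
  exact ⟨a, .single ha haC⟩

theorem exists_isReduced_true : ∃ b, IsReduced G C true true b := by
  obtain ⟨b, hb, hbC⟩ := H.exists_true
  exact ⟨b, .single hb hbC⟩

/-- A reduced word of length at least two ending in `G true` moves the base half-tree onto a set
containing a half-tree all of whose elements have the same first letter. -/
theorem exists_smul_subset_smul {i : Bool} {g : Γ} (hg : IsReduced G C i true g) :
    (i = true ∧ g ∈ G true ∧ g ∉ C) ∨
      ∃ h, IsReduced G C i false h ∧ h • P ⊆ g • P := by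
  rcases hg.last with h | ⟨w, b, hw, hb, hbC, rfl⟩
  · exact .inl h
  · right
    obtain ⟨a, ha, hwa⟩ := H.exists_isReduced_mul hw
    refine ⟨w * a, hwa, ?_⟩
    rw [mul_smul, mul_smul, Set.smul_set_subset_smul_set_iff]
    refine (H.smul_subset_compl_baseHalf ha).trans ?_
    rw [Set.subset_smul_set_iff]
    exact H.smul_compl_subset_baseHalf (IsReduced.single hb hbC).inv

theorem exists_subset_or_subset_compl (g : Γ) :
    ∃ h : Γ, h • P ⊆ g • P ∧ (h • P ⊆ P ∨ h • P ⊆ Pᶜ) := by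
  have key : ∀ i h, IsReduced G C i false h → h • P ⊆ P ∨ h • P ⊆ Pᶜ := by
    rintro (_ | _) h hh
    · exact .inr (H.smul_subset_compl_baseHalf hh)
    · exact .inl (H.smul_subset_baseHalf hh)
  rcases H.mem_or_isReduced g with hg | ⟨i, _ | _, hg⟩
  · exact ⟨g, subset_rfl, .inl (H.smul_baseHalf_of_mem hg).subset⟩
  · exact ⟨g, subset_rfl, key i g hg⟩
  · rcases H.exists_smul_subset_smul hg with ⟨rfl, h1, h2⟩ | ⟨h, hh, hs⟩
    · obtain ⟨a, ha⟩ := H.exists_isReduced_false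
      refine ⟨a, (H.smul_subset_compl_baseHalf ha).trans ?_, key _ a ha⟩
      rw [Set.subset_smul_set_iff]
      exact H.smul_compl_subset_baseHalf (IsReduced.single h1 h2).inv
    · exact ⟨h, hs, key i h hh⟩

/-- Of two half-trees, the first contains one lying inside or outside of the second. -/
theorem exists_subset_smul_or (g k : Γ) :
    ∃ h : Γ, h • P ⊆ g • P ∧ (h • P ⊆ k • P ∨ h • P ⊆ (k • P)ᶜ) := by
  obtain ⟨h, h1, h2⟩ := H.exists_subset_or_subset_compl (k⁻¹ * g)
  refine ⟨k * h, ?_, ?_⟩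
  · rw [mul_smul, Set.smul_set_subset_iff_subset_inv_smul_set, ← mul_smul]
    exact h1
  · rw [mul_smul, ← Set.smul_set_compl, Set.smul_set_subset_smul_set_iff,
      Set.smul_set_subset_smul_set_iff]
    exact h2

/-- For each of the four patterns of first and last letter of `u`, a half-tree lies in one of `P`,
`u • P` and off the other. -/
theorem mem_of_forall_not_subset {u : Γ} (h1 : ∀ h : Γ, ¬ (h • P ⊆ u • P ∧ h • P ⊆ Pᶜ))
    (h2 : ∀ h : Γ, ¬ (h • P ⊆ P ∧ h • P ⊆ (u • P)ᶜ)) : u ∈ C := by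
  rcases H.mem_or_isReduced u with hu | ⟨_ | _, _ | _, hu⟩
  · exact hu
  · exact absurd ⟨subset_rfl, H.smul_subset_compl_baseHalf hu⟩ (h1 u)
  · rcases H.exists_smul_subset_smul hu with ⟨h, -⟩ | ⟨h, hh, hs⟩
    · simp at h
    · exact absurd ⟨hs, H.smul_subset_compl_baseHalf hh⟩ (h1 h)
  · rcases H.exists_smul_subset_smul hu.inv with ⟨h, -⟩ | ⟨h, hh, hs⟩
    · simp at h
    · refine absurd ⟨?_, ?_⟩ (h2 (u * h))
      · rw [mul_smul, Set.smul_set_subset_iff_subset_inv_smul_set]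
        exact hs
      · rw [mul_smul, ← Set.smul_set_compl, Set.smul_set_subset_smul_set_iff]
        exact H.smul_subset_compl_baseHalf hh
  · obtain ⟨a, ha⟩ := H.exists_isReduced_false
    have hs := H.smul_subset_compl_baseHalf ha
    refine absurd ⟨?_, ?_⟩ (h2 (u * a))
    · rw [mul_smul]
      exact (Set.smul_set_mono hs).trans fun x hx => .inr (H.isReduced_of_mem_smul_compl hu hx)
    · rw [mul_smul, ← Set.smul_set_compl, Set.smul_set_subset_smul_set_iff]
      exact hs

/-- If `g` moves no half-tree inside the base half-tree off itself, then it fixes all edges `k` with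
`k • P ⊆ P`. -/
theorem conj_mem_of_smul_subset {g : Γ} (hg : ∀ h : Γ, h • P ⊆ P → ¬ g • h • P ⊆ (h • P)ᶜ) {k : Γ}
    (hk : k • P ⊆ P) : k⁻¹ * g * k ∈ C := by
  apply H.mem_of_forall_not_subset
  -- The half-tree `(k * h) • P` lies in `g • k • P` and off `k • P`, so its preimage under `g` lies
  -- in `k • P` and is moved off itself.
  · rintro h ⟨h1, h2⟩
    have hx : (g⁻¹ * k * h) • P ⊆ k • P := by
      rw [Set.smul_set_subset_iff_subset_inv_smul_set] at h1 ⊢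
      simpa [mul_smul] using h1
    refine hg _ (hx.trans hk) (Set.subset_compl_comm.1 (hx.trans ?_))
    rw [← Set.smul_set_subset_smul_set_iff (a := k), Set.smul_set_compl] at h2
    rw [Set.subset_compl_comm] at h2
    simpa [mul_smul] using h2
  · rintro h ⟨h1, h2⟩
    have hx : (k * h) • P ⊆ k • P := by
      rwa [mul_smul, Set.smul_set_subset_smul_set_iff]
    refine hg _ (hx.trans hk) ((Set.smul_set_mono hx).trans ?_)
    rw [Set.subset_compl_comm, ← Set.smul_set_subset_smul_set_iff (a := k),
      ← Set.smul_set_compl, Set.smul_set_compl, Set.smul_set_compl] at h2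
    rw [Set.subset_compl_comm] at h2 ⊢
    simpa [mul_smul] using h2

/-- If `k` ends in `G true`, then `k • P` need not lie in `P`, but the adjacent edges `k * a` with
`a ∈ G false` outside `C` are covered by the previous lemma. -/
theorem conj_mem {g : Γ} (hg : ∀ h : Γ, h • P ⊆ P → ¬ g • h • P ⊆ (h • P)ᶜ) {k : Γ}
    (hk : k ∈ P) : k⁻¹ * g * k ∈ C := by
  rcases hk with hk | ⟨_ | _, hk⟩
  · exact H.conj_mem_of_smul_subset hg (H.smul_baseHalf_of_mem hk).subset
  · exact H.conj_mem_of_smul_subset hg (H.smul_subset_baseHalf hk)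
  · set u := k⁻¹ * g * k with hu
    have key : ∀ a ∈ G false, a ∉ C → a⁻¹ * u * a ∈ C := by
      intro a ha haC
      have := H.conj_mem_of_smul_subset hg
        (H.smul_subset_baseHalf (.append hk (.single (i := false) ha haC)))
      simpa [hu, mul_assoc] using this
    by_contra huC
    obtain ⟨a, ha, haC, -⟩ := H.exists_false 1 (one_mem _)
    have huA : u ∈ G false := by
      have := mul_mem (mul_mem ha (H.le false (key a ha haC))) (inv_mem ha)
      simpa [mul_assoc] using this
    -- `u` itself serves as the letter `a`, since `u⁻¹ * u * u = u`.
    exact huC (by simpa using key u huA huC)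

theorem mul_mem_baseHalf {i : Bool} {k x : Γ} (hk : k ∈ P) (hx : x ∈ G i) :
    k * x ∈ P ∨ k * x ∈ G false := by
  have htrue : ∀ y ∈ G true, y ∈ P := fun y hy => by
    by_cases h : y ∈ C
    · exact .inl h
    · exact .inr ⟨true, .single hy h⟩
  rcases hk with hk | ⟨j, hk⟩
  · cases i
    · exact .inr (mul_mem (H.le _ hk) hx)
    · exact .inl (htrue _ (mul_mem (H.le _ hk) hx))
  · left
    by_cases hxC : x ∈ C
    · exact .inr ⟨j, H.isReduced_mul_base hk hxC⟩
    by_cases hij : i = j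
    · subst hij
      rcases hk.last with ⟨rfl, h1, h2⟩ | ⟨w, y, hw, hy, hC, rfl⟩
      · exact htrue _ (mul_mem h1 hx)
      · rw [mul_assoc]
        by_cases h : y * x ∈ C
        · exact .inr ⟨_, H.isReduced_mul_base hw h⟩
        · exact .inr ⟨_, .append hw (by simpa using IsReduced.single (mul_mem hy hx) h)⟩
    · obtain rfl : i = !j := by cases i <;> cases j <;> simp_all
      exact .inr ⟨_, .append hk (.single hx hxC)⟩

/-! ### Large balls inside the base half-tree -/

/-- The edges for which the ball of radius `n` around them lies in the base half-tree. -/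
def deep (G : Bool → Subgroup Γ) (C : Subgroup Γ) : ℕ → Set Γ
  | 0 => baseHalf G C
  | n + 1 => {k | ∀ i, ∀ x ∈ G i, k * x ∈ deep G C n}

/-- Only edges at the `G false` vertex of the base edge can have neighbours outside `P`, and these
neighbours lie in `G false`; translating by `b * a` brings them into `P` too. -/
theorem mul_mem_deep {a b : Γ} (ha : a ∈ G false) (haC : a ∉ C)
    (hb : b ∈ G true) (hbC : b ∉ C) :
    ∀ (n : ℕ) {k : Γ}, k ∈ deep G C n → b * a * k ∈ deep G C (n + 1) := by
  have hba : (b * a) • P ⊆ P :=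
    H.smul_subset_baseHalf (.append (.single hb hbC) (.single (i := false) ha haC))
  intro n
  induction n with
  | zero =>
    intro k hk i x hx
    rw [mul_assoc]
    rcases H.mul_mem_baseHalf hk hx with h | h
    · exact hba (Set.smul_mem_smul_set h)
    · rw [mul_assoc]
      by_cases hC : a * (k * x) ∈ C
      · exact .inr ⟨true, H.isReduced_mul_base (.single hb hbC) hC⟩
      · exact .inr ⟨false, .append (.single hb hbC) (.single (i := false) (mul_mem ha h) hC)⟩
  | succ n ih =>
    intro k hk i x hx
    rw [mul_assoc]
    exact ih (hk i x hx)

theorem deep_nonempty (n : ℕ) : (deep G C n).Nonempty := by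
  obtain ⟨a, ha, haC, -⟩ := H.exists_false 1 (one_mem _)
  obtain ⟨b, hb, hbC⟩ := H.exists_true
  induction n with
  | zero => exact ⟨1, .inl (one_mem C)⟩
  | succ n ih =>
    obtain ⟨k, hk⟩ := ih
    exact ⟨_, H.mul_mem_deep ha haC hb hbC n hk⟩

end IsNondegenerate

/-! ### Free motion of half-trees and the Powers property -/

/-- The amalgams as in `IsNondegenerate` for which some ball around the base edge has trivial
pointwise stabilizer. -/
structure IsSlender (G : Bool → Subgroup Γ) (C : Subgroup Γ) : Prop extends
    IsNondegenerate G C where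
  exists_core : ∃ K : ℕ → Set Γ, (∀ u ∈ C, u ∈ K 0) ∧
    (∀ n, ∀ u ∈ C, (∀ i, ∀ x ∈ G i, x⁻¹ * u * x ∈ K n) → u ∈ K (n + 1)) ∧ ∃ n, K n ⊆ {1}

namespace IsSlender

variable {G : Bool → Subgroup Γ} {C : Subgroup Γ} (H : IsSlender G C)

include H

local notation "P" => baseHalf G C

theorem eq_one {g : Γ} (hg : ∀ h : Γ, h • P ⊆ P → ¬ g • h • P ⊆ (h • P)ᶜ) : g = 1 := by
  obtain ⟨K, hK0, hK, n, hn⟩ := H.exists_core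
  have key : ∀ m, ∀ k ∈ IsNondegenerate.deep G C m, k⁻¹ * g * k ∈ C ∧ k⁻¹ * g * k ∈ K m := by
    intro m
    induction m with
    | zero => exact fun k hk => ⟨H.conj_mem hg hk, hK0 _ (H.conj_mem hg hk)⟩
    | succ m ih =>
      intro k hk
      have hC : k⁻¹ * g * k ∈ C := by
        simpa using (ih (k * 1) (hk true 1 (one_mem _))).1
      refine ⟨hC, hK m _ hC fun i x hx => ?_⟩
      simpa [mul_assoc] using (ih (k * x) (hk i x hx)).2
  obtain ⟨k, hk⟩ := H.deep_nonempty n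
  have := hn (key n k hk).2
  rw [Set.mem_singleton_iff, mul_assoc, inv_mul_eq_one] at this
  simpa using this.symm

theorem exists_smul_subset_compl {g : Γ} (hg : g ≠ 1) (k : Γ) :
    ∃ h : Γ, h • P ⊆ k • P ∧ g • h • P ⊆ (h • P)ᶜ := by
  by_contra! hcon
  have : k⁻¹ * g * k = 1 := by
    refine H.eq_one fun h h1 h2 => hcon (k * h) ?_ ?_
    · rwa [mul_smul, Set.smul_set_subset_smul_set_iff]
    · rw [← Set.smul_set_subset_smul_set_iff (a := k), Set.smul_set_compl] at h2
      simpa [mul_smul] using h2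
  rw [mul_assoc, inv_mul_eq_one] at this
  exact hg (by simpa using this.symm)

theorem exists_forall_smul_subset_compl (F : Finset Γ) (hF : (1 : Γ) ∉ F) :
    ∃ h : Γ, ∀ f ∈ F, f • h • P ⊆ (h • P)ᶜ := by
  classical
  induction F using Finset.induction_on with
  | empty => exact ⟨1, by simp⟩
  | insert f F _ ih =>
    rw [Finset.mem_insert, not_or] at hF
    obtain ⟨k, hk⟩ := ih hF.2
    obtain ⟨h, h1, h2⟩ := H.exists_smul_subset_compl (Ne.symm hF.1) k
    refine ⟨h, fun x hx => ?_⟩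
    rcases Finset.mem_insert.1 hx with rfl | hx
    · exact h2
    · exact ((Set.smul_set_mono h1).trans (hk x hx)).trans (Set.compl_subset_compl.2 h1)

/-- A nontrivial subnormal subgroup moves every half-tree into every other one. -/
theorem exists_smul_subset_smul_of_isSubnormal {N : Subgroup Γ} (hN : N.IsSubnormal)
    (hbot : N ≠ ⊥) (j k : Γ) : ∃ n ∈ N, n • j • P ⊆ k • P := by
  obtain ⟨a, ha⟩ := H.exists_isReduced_false
  obtain ⟨b, hb⟩ := H.exists_isReduced_true
  induction hN generalizing j k with
  | top =>
    refine ⟨k * (b * a) * j⁻¹, Subgroup.mem_top _, ?_⟩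
    rw [mul_smul, inv_smul_smul, mul_smul, Set.smul_set_subset_smul_set_iff]
    exact H.smul_subset_baseHalf (.append hb ha)
  | step N M hle hM hnorm ih =>
    have ih := ih (fun h => hbot (by rw [h] at hle; exact le_bot_iff.1 hle))
    obtain ⟨n, hn, hn1⟩ := (Subgroup.ne_bot_iff_exists_ne_one.1 hbot).elim
      fun n hn => (⟨n, n.2, by simpa using hn⟩ : ∃ n ∈ N, n ≠ 1)
    obtain ⟨h, -, hh⟩ := H.exists_smul_subset_compl hn1 1
    have key : ∀ j k : Γ, k • P ⊆ (j • P)ᶜ → ∃ n ∈ N, n • j • P ⊆ k • P := by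
      intro j k hjk
      -- The complement of `h • P` need not be a translate of `P`, but it lies in the translate `(h
      -- * b⁻¹) • P`.
      obtain ⟨m, hm, hmk⟩ := ih (h * b⁻¹) k
      have hmh : m • (h • P)ᶜ ⊆ k • P := by
        refine (Set.smul_set_mono ?_).trans hmk
        rw [← Set.smul_set_compl, mul_smul, Set.smul_set_subset_smul_set_iff,
          Set.subset_smul_set_iff, inv_inv]
        exact H.smul_compl_subset_baseHalf hb
      -- `m⁻¹` brings `j • P` into `h • P`, `n` throws it into the complement, and `m` sends that
      -- into `k • P`.
      refine ⟨m * n * m⁻¹, ?_, ?_⟩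
      · have := hnorm.conj_mem ⟨n, hle hn⟩ hn ⟨m, hm⟩
        simpa [Subgroup.mem_subgroupOf] using this
      · have hj : m⁻¹ • j • P ⊆ h • P := by
          rw [← Set.subset_smul_set_iff, ← Set.compl_subset_compl, ← Set.smul_set_compl]
          exact hmh.trans hjk
        rw [mul_smul, mul_smul]
        refine (Set.smul_set_mono ((Set.smul_set_mono hj).trans hh)).trans hmh
    obtain ⟨k', hk', hj | hj⟩ := H.exists_subset_smul_or k j
    -- When the target lies inside `j • P`, a detour is needed: `n₁` first moves `j • P` off itself,
    -- hence off the target.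
    · obtain ⟨n₁, hn₁, hs⟩ := key j (j * a) (by
        rw [mul_smul, ← Set.smul_set_compl, Set.smul_set_subset_smul_set_iff]
        exact H.smul_subset_compl_baseHalf ha)
      have hs' : (n₁ * j) • P ⊆ (j • P)ᶜ := by
        rw [mul_smul]
        refine hs.trans ?_
        rw [mul_smul, ← Set.smul_set_compl, Set.smul_set_subset_smul_set_iff]
        exact H.smul_subset_compl_baseHalf ha
      obtain ⟨n₂, hn₂, ht⟩ := key (n₁ * j) k' (hj.trans (Set.subset_compl_comm.1 hs'))
      refine ⟨n₂ * n₁, mul_mem hn₂ hn₁, ?_⟩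
      rw [mul_smul n₁] at ht
      rw [mul_smul]
      exact ht.trans hk'
    · obtain ⟨n, hn, hs⟩ := key j k' hj
      exact ⟨n, hn, hs.trans hk'⟩

/-- Ping-pong: `x • P` and `y • P` are disjoint inside `P`, so the half-trees `x ^ i • y • P` are
pairwise disjoint. -/
theorem exists_pairwise_disjoint :
    ∃ k : ℕ → Γ, Pairwise fun i j => Disjoint (k i • P) (k j • P) := by
  obtain ⟨b, hb⟩ := H.exists_isReduced_true
  obtain ⟨a, ha⟩ := H.exists_isReduced_false
  obtain ⟨a', ha', haa'⟩ := H.exists_isReduced_mul (ha.inv)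
  set x := b * a with hx
  set y := b * a' with hy
  have hxP : x • P ⊆ P := H.smul_subset_baseHalf (.append hb ha)
  have hyP : y • P ⊆ P := H.smul_subset_baseHalf (.append hb ha')
  have hxy : y • P ⊆ (x • P)ᶜ := by
    rw [hx, hy, mul_smul, mul_smul, ← Set.smul_set_compl, Set.smul_set_subset_smul_set_iff,
      ← Set.smul_set_compl, Set.subset_smul_set_iff, ← mul_smul]
    exact H.smul_subset_compl_baseHalf haa'
  have hpow : ∀ n : ℕ, x ^ n • P ⊆ P := by
    intro n
    induction n with
    | zero => simp
    | succ n ih =>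
      rw [pow_succ, mul_smul]
      exact (Set.smul_set_mono hxP).trans ih
  refine ⟨fun i => x ^ i * y, ?_⟩
  have key : ∀ i d : ℕ, Disjoint ((x ^ i * y) • P) ((x ^ (i + 1 + d) * y) • P) := by
    intro i d
    rw [← Set.subset_compl_iff_disjoint_right, mul_smul]
    refine (Set.smul_set_mono hxy).trans ?_
    rw [Set.smul_set_compl, Set.compl_subset_compl, pow_add, pow_succ, mul_assoc, mul_assoc,
      mul_smul, Set.smul_set_subset_smul_set_iff, mul_smul, Set.smul_set_subset_smul_set_iff,
      mul_smul]
    exact (Set.smul_set_mono hyP).trans (hpow d)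
  intro i j hij
  rcases lt_or_gt_of_ne hij with h | h
  · obtain ⟨d, rfl⟩ := Nat.exists_eq_add_of_le (Nat.succ_le_of_lt h)
    exact key i d
  · obtain ⟨d, rfl⟩ := Nat.exists_eq_add_of_le (Nat.succ_le_of_lt h)
    exact (key j d).symm

theorem isStronglyPowersGroup : IsStronglyPowersGroup Γ := by
  intro N hN hbot
  refine ⟨(Subgroup.nontrivial_iff_ne_bot N).2 hbot, fun F hF n _ => ?_⟩
  obtain ⟨h, hh⟩ := H.exists_forall_smul_subset_compl (F.map ⟨_, N.subtype_injective⟩)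
    (by simpa using hF)
  obtain ⟨b, hb⟩ := H.exists_isReduced_true
  obtain ⟨k, hk⟩ := H.exists_pairwise_disjoint
  have hγ : ∀ i : ℕ, ∃ γ : N, (γ : Γ) • (h • P)ᶜ ⊆ k i • P := by
    intro i
    obtain ⟨m, hm, hmk⟩ := H.exists_smul_subset_smul_of_isSubnormal hN hbot (h * b⁻¹) (k i)
    refine ⟨⟨m, hm⟩, (Set.smul_set_mono ?_).trans hmk⟩
    rw [← Set.smul_set_compl, mul_smul, Set.smul_set_subset_smul_set_iff,
      Set.subset_smul_set_iff, inv_inv]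
    exact H.smul_compl_subset_baseHalf hb
  choose γ hγ using hγ
  refine ⟨{x | (x : Γ) ∈ h • P}, {x | (x : Γ) ∈ h • P}ᶜ, Set.union_compl_self _,
    Set.inter_compl_self _, fun i => γ i, ?_, ?_⟩
  · rintro f hf
    rw [Set.eq_empty_iff_forall_notMem]
    rintro _ ⟨⟨x, hx, rfl⟩, hx'⟩
    exact hh f (by simpa using hf) (Set.smul_mem_smul_set hx) hx'
  · intro i j hij
    rw [Set.eq_empty_iff_forall_notMem]
    rintro z ⟨⟨x, hx, rfl⟩, ⟨y, hy, hxy⟩⟩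
    have h1 := hγ i (Set.smul_mem_smul_set hx)
    have h2 := hγ j (Set.smul_mem_smul_set hy)
    have h3 : (γ j : Γ) • (y : Γ) = (γ i : Γ) • (x : Γ) := congrArg Subtype.val hxy
    rw [h3] at h2
    exact Set.disjoint_left.1 (hk (fun h => hij (Fin.ext h))) h1 h2

end IsSlender

/-! ### The pushout as an amalgam of subgroups -/

section Pushout

variable {A B : Type u} {C : Type v} [Group A] [Group B] [Group C] (ιA : C →* A) (ιB : C →* B)

/-- The images of the two factors in the amalgam. -/
def factor (i : Bool) : Subgroup (Amalgam ιA ιB) :=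
  (PushoutI.of (φ := amalgamMap ιA ιB) i).range

/-- The image of the amalgamated subgroup in the amalgam. -/
def edge : Subgroup (Amalgam ιA ιB) := (PushoutI.base (amalgamMap ιA ιB)).range

variable {ιA ιB}

theorem exists_list_of_isReduced {i j : Bool} {g : Amalgam ιA ιB}
    (hg : IsReduced (factor ιA ιB) (edge ιA ιB) i j g) :
    ∃ l : List (Σ i, AmalgamFactor A B i),
      l.head?.map Sigma.fst = some i ∧ l.getLast?.map Sigma.fst = some j ∧
      l.IsChain (fun x y => x.1 ≠ y.1) ∧ (∀ x ∈ l, x.2 ∉ (amalgamMap ιA ιB x.1).range) ∧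
      (l.map fun x => PushoutI.of (φ := amalgamMap ιA ιB) x.1 x.2).prod = g := by
  induction hg with
  | @single i x hx hC =>
    obtain ⟨y, rfl⟩ := hx
    refine ⟨[⟨i, y⟩], rfl, rfl, by simp, ?_, by simp⟩
    simp only [List.mem_singleton, forall_eq]
    rintro ⟨c, hc⟩
    exact hC ⟨c, by rw [← hc, PushoutI.of_apply_eq_base]⟩
  | @append i j k g h _ _ ihg ihh =>
    obtain ⟨l, h1, h2, h3, h4, rfl⟩ := ihg
    obtain ⟨l', h1', h2', h3', h4', rfl⟩ := ihh
    refine ⟨l ++ l', ?_, ?_, ?_, ?_, by simp⟩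
    · cases l <;> simp_all
    · rw [List.getLast?_append]
      cases h : l'.getLast? <;> simp_all
    · refine List.isChain_append.2 ⟨h3, h3', fun x hx y hy => ?_⟩
      rw [Option.mem_def] at hx hy
      rw [hx] at h2
      rw [hy] at h1'
      simp only [Option.map_some, Option.some.injEq] at h2 h1'
      rw [h2, h1']
      cases j <;> simp
    · intro x hx
      rcases List.mem_append.1 hx with hx | hx
      exacts [h4 x hx, h4' x hx]

theorem amalgamMap_injective (hιA : Function.Injective ιA) (hιB : Function.Injective ιB) :
    ∀ i, Function.Injective (amalgamMap ιA ιB i)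
  | false => hιA
  | true => hιB

theorem isAmalgam_factor (hιA : Function.Injective ιA) (hιB : Function.Injective ιB) :
    IsAmalgam (factor ιA ιB) (edge ιA ιB) where
  le := by
    rintro i _ ⟨c, rfl⟩
    exact ⟨amalgamMap ιA ιB i c, PushoutI.of_apply_eq_base _ i c⟩
  sup_eq_top := by
    have hle : ∀ i, factor ιA ιB i ≤ factor ιA ιB false ⊔ factor ιA ιB true := by
      rintro (_ | _)
      exacts [le_sup_left, le_sup_right]
    refine top_le_iff.1 fun g _ => ?_
    induction g using PushoutI.induction_on with
    | of i x => exact hle i ⟨x, rfl⟩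
    | base c =>
      exact hle false ⟨amalgamMap ιA ιB false c, PushoutI.of_apply_eq_base _ false c⟩
    | mul x y hx hy => exact mul_mem (hx trivial) (hy trivial)
  notMem := by
    intro i j g hg hmem
    obtain ⟨l, h1, -, h3, h4, rfl⟩ := exists_list_of_isReduced hg
    let w : CoprodI.Word (AmalgamFactor A B) :=
      ⟨l, fun x hx h => h4 x hx (h ▸ one_mem _), h3⟩
    have hw : PushoutI.Reduced (amalgamMap ιA ιB) w := h4
    -- Normal form theorem: a reduced word with value in the base group is empty.
    have := hw.eq_empty_of_mem_range (amalgamMap_injective hιA hιB) (by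
      rw [CoprodI.Word.prod, map_list_prod, List.map_map]
      simp only [Function.comp_def, PushoutI.ofCoprodI_of]
      exact hmem)
    have hl : l = [] := congrArg CoprodI.Word.toList this
    simp [hl] at h1

theorem of_mem_edge_iff (hιA : Function.Injective ιA) (hιB : Function.Injective ιB) {i : Bool}
    {x : AmalgamFactor A B i} :
    PushoutI.of (φ := amalgamMap ιA ιB) i x ∈ edge ιA ιB ↔ x ∈ (amalgamMap ιA ιB i).range := by
  constructor
  · rintro ⟨c, hc⟩
    refine ⟨c, PushoutI.of_injective (amalgamMap_injective hιA hιB) i ?_⟩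
    rw [PushoutI.of_apply_eq_base, hc]
  · rintro ⟨c, rfl⟩
    exact ⟨c, (PushoutI.of_apply_eq_base _ i c).symm⟩

theorem exists_notMem_of_two_le {B : Type*} [Group B] {S : Subgroup B}
    (h : 2 ≤ ENat.card (B ⧸ S)) : ∃ b, b ∉ S := by
  by_contra! hS
  obtain rfl : S = ⊤ := top_le_iff.1 fun x _ => hS x
  have : ENat.card (B ⧸ (⊤ : Subgroup B)) ≤ 1 :=
    ENat.card_le_one_iff_subsingleton _ |>.2 QuotientGroup.subsingleton_quotient_top
  exact absurd (h.trans this) (by norm_num)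

theorem exists_notMem_of_three_le {A : Type*} [Group A] {S : Subgroup A}
    (h : 3 ≤ ENat.card (A ⧸ S)) (x : A) : ∃ a, a ∉ S ∧ x * a ∉ S := by
  by_contra! hS
  have huniv : (Set.univ : Set (A ⧸ S)) ⊆ {((1 : A) : A ⧸ S), ((x⁻¹ : A) : A ⧸ S)} := by
    intro q _
    induction q using QuotientGroup.induction_on with | _ a =>
    by_cases ha : a ∈ S
    · exact .inl (QuotientGroup.eq.2 (by simpa using ha))
    · exact .inr (QuotientGroup.eq.2 (by simpa using inv_mem (hS a ha)))
  have h2 := (Set.encard_le_encard huniv).trans (Set.encard_insert_le _ _)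
  rw [Set.encard_univ, Set.encard_singleton] at h2
  exact absurd (h.trans h2) (by norm_num)

theorem mem_interConjugates {A : Type u} [Group A] {ι : C →* A} {S : Subgroup C} {c : C}
    (h : ∀ a : A, ∃ s ∈ S, ι s = a * ι c * a⁻¹) : c ∈ interConjugates ι S := by
  rw [interConjugates, Subgroup.mem_comap, Subgroup.mem_iInf]
  intro a
  obtain ⟨s, hs, hsc⟩ := h a
  exact ⟨ι s, ⟨s, hs, rfl⟩, by simp [hsc, mul_assoc]⟩

theorem isSlender_factor (hιA : Function.Injective ιA) (hιB : Function.Injective ιB)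
    (hA : 3 ≤ ENat.card (A ⧸ ιA.range)) (hB : 2 ≤ ENat.card (B ⧸ ιB.range))
    (hcore : ∃ k : ℕ, amalgamCore ιA ιB k = ⊥) :
    IsSlender (factor ιA ιB) (edge ιA ιB) where
  toIsAmalgam := isAmalgam_factor hιA hιB
  exists_false := by
    rintro _ ⟨x, rfl⟩
    obtain ⟨a, ha, hxa⟩ := exists_notMem_of_three_le hA (x : A)
    refine ⟨_, ⟨a, rfl⟩, fun h => ha ((of_mem_edge_iff hιA hιB).1 h), fun h => hxa ?_⟩
    refine (of_mem_edge_iff hιA hιB (i := false)).1 (?_ : PushoutI.of false (x * show AmalgamFactor A B false from a) ∈ _)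
    rw [map_mul]
    exact h
  exists_true := by
    obtain ⟨b, hb⟩ := exists_notMem_of_two_le hB
    exact ⟨_, ⟨b, rfl⟩, fun h => hb ((of_mem_edge_iff hιA hιB).1 h)⟩
  exists_core := by
    refine ⟨fun n => (amalgamCore ιA ιB n).map (PushoutI.base (amalgamMap ιA ιB)), ?_, ?_, ?_⟩
    · rintro _ ⟨c, rfl⟩
      exact ⟨c, Subgroup.mem_top c, rfl⟩
    · rintro n _ ⟨c, rfl⟩ h
      have key : ∀ (i : Bool) (x : AmalgamFactor A B i), ∃ s ∈ amalgamCore ιA ιB n,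
          amalgamMap ιA ιB i s = x * amalgamMap ιA ιB i c * x⁻¹ := by
        intro i x
        -- The inverse appears because `c ∈ x⁻¹ S x` means `x c x⁻¹ ∈ S`.
        obtain ⟨s, hs, hsc⟩ := h i (PushoutI.of i x⁻¹) ⟨_, rfl⟩
        refine ⟨s, hs, PushoutI.of_injective (amalgamMap_injective hιA hιB) i ?_⟩
        rw [PushoutI.of_apply_eq_base, hsc]
        simp [PushoutI.of_apply_eq_base]
      exact ⟨c, ⟨mem_interConjugates (key false), mem_interConjugates (key true)⟩, rfl⟩
    · obtain ⟨n, hn⟩ := hcore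
      refine ⟨n, ?_⟩
      rintro _ ⟨c, hc, rfl⟩
      rw [hn] at hc
      rw [Set.mem_singleton_iff, Subgroup.mem_bot.1 hc, map_one]

end Pushout

end BassSerre

theorem proposition1p3 {A B : Type u} {C : Type v} [Group A] [Group B] [Group C]
    (ιA : C →* A) (ιB : C →* B)
    (hιA : Function.Injective ιA) (hιB : Function.Injective ιB)
    (hcountable : Countable (Amalgam ιA ιB))
    (hA : 3 ≤ ENat.card (A ⧸ ιA.range)) (hB : 2 ≤ ENat.card (B ⧸ ιB.range))
    (hcore : ∃ k : ℕ, amalgamCore ιA ιB k = ⊥) :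
    IsStronglyPowersGroup (Amalgam ιA ιB) :=
  (BassSerre.isSlender_factor hιA hιB hA hB hcore).isStronglyPowersGroup
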